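/- Let $\mathcal N$ be a network: a finite directed acyclic multigraph $(\mathcal V,\mathcal E)$ with $s$ distinct source nodes $\sigma_1,\dots,\sigma_s$, none of which has an incoming edge, and a sink node $\gamma\notin\{\sigma_1,\dots,\sigma_s\}$ that is reachable by a directed path from every other node. A cut of $\mathcal N$ is a set $C\subseteq\mathcal E$ which, for some $i$, meets every path from $\sigma_i$ to $\gamma$; let $\Lambda(\mathcal N)$ be the set of all cuts. For a finite field $\mathbb F_q$ and a matrix $T\in\mathbb F_q^{s\times l}$, a $(k,n)$ network code for $T$ over $\mathbb F_q$ (with $k,n\ge 1$) works as follows. Each source $\sigma_i$ holds $k$ symbols $x_{i1},\dots,x_{ik}\in\mathbb F_q$. Each edge $e$ carries a word $u_e\in\mathbb F_q^n$: for an edge leaving $\sigma_i$, $u_e$ is an arbitrary (not necessarily linear) function of $(x_{i1},\dots,x_{ik})$ plus an error $z_e\in\mathbb F_q^n$; for any other edge, $u_e$ is an arbitrary function of the words on the edges entering the tail of $e$, plus an error $z_e\in\mathbb F_q^n$. From the words on the edges entering $\gamma$, a decoding function outputs $k$ vectors in $\mathbb F_q^l$. The code computes $\mathbf x\mapsto \mathbf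 x\cdot T$ against $\tau$ errors if these vectors are $(x_{1j},\dots,x_{sj})\cdot T$, $1\le j\le k$, for all source messages and all errors with $z_e\neq 0$ for at most $\tau$ edges $e$. The robust computing capacity $C(\mathcal N,T,\tau)$ is the supremum of $k/n$ over all $(k,n)$ network codes over $\mathbb F_q$ that compute $\mathbf x\mapsto\mathbf x\cdot T$ against $\tau$ errors. **Theorem.** Let $\mathcal N$ be such a network and let $\tau\ge 0$ be an integer with $2\tau<\min_{C\in\Lambda(\mathcal N)}|C|$. Then there is a number $q_0$, depending only on $\mathcal N$ and $\tau$, such that for every finite field $\mathbb F_q$ with $q\ge q_0$, every $l\ge 1$ and every $T\in\mathbb F_q^{s\times l}$ of full column rank, $$C(\mathcal N,T,\tau)\;\ge\;\min_{C\in\Lambda(\mathcal N)}\frac{|C|-2\tau}{l}.$$ -/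

import Mathlib

/-- A directed multigraph with vertex set `V` and edge set `E`. -/
structure DirMultigraph (V E : Type*) where
  tail : E → V
  head : E → V

/-- `G.IsPath u v p`: the nonempty edge sequence `p` is a (directed) path from `u` to `v`. -/
inductive DirMultigraph.IsPath {V E : Type*} (G : DirMultigraph V E) : V → V → List E → Prop
  | single (e : E) : G.IsPath (G.tail e) (G.head e) [e]
  | cons (e : E) {v : V} {p : List E} (hp : G.IsPath (G.head e) v p) :
      G.IsPath (G.tail e) v (e :: p)

/-- A network on an acyclic directed multigraph, with `s` distinct source nodes and one sink.
Sources have no incoming edges, and the sink can be reached from every other node. -/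
structure Network (V E : Type*) (s : ℕ) extends DirMultigraph V E where
  source : Fin s → V
  sink : V
  acyclic : ∀ v p, ¬ toDirMultigraph.IsPath v v p
  source_injective : Function.Injective source
  sink_ne_source : ∀ i, sink ≠ source i
  no_edge_into_source : ∀ e i, head e ≠ source i
  path_to_sink : ∀ v, v ≠ sink → ∃ p, toDirMultigraph.IsPath v sink p

namespace Network

variable {V E : Type*} {s : ℕ}

/-- The cuts of the network: the sets of edges that, for some source node, meet every path from
that source node to the sink. -/
def cuts (N : Network V E s) : Set (Finset E) :=
  {C | ∃ i, ∀ p, N.IsPath (N.source i) N.sink p → ∃ e ∈ p, e ∈ C}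

/-- The edges entering the node `v`. -/
abbrev In (N : Network V E s) (v : V) : Type _ := {d : E // N.head d = v}

/-- A (not necessarily linear) `(k, n)` network code over the alphabet `B`, for source messages in
`A ^ k` and results in `O ^ k`. Every edge carries a word in `B ^ n`. An edge `e` leaving the
`i`-th source node uses the encoder `srcEnc i e`, any other edge `e` uses `relayEnc e`
(the values of `srcEnc i e` for edges `e` that do not leave the `i`-th source node, and those of
`relayEnc e` for edges `e` that leave a source node, play no role). -/
structure Code (N : Network V E s) (A B O : Type*) (k n : ℕ) where
  srcEnc : Fin s → E → (Fin k → A) → (Fin n → B)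
  relayEnc : (e : E) → (N.In (N.tail e) → Fin n → B) → (Fin n → B)
  decode : (N.In N.sink → Fin n → B) → (Fin k → O)

namespace Code

variable {N : Network V E s} {A B O : Type*} [AddCommGroup B] {k n : ℕ}

/-- `c.IsTransmission x z u`: when the source messages are `x` and the error vector is `z`
(with the word `z e` added on the edge `e`), the word carried by each edge `e` is `u e`. -/
structure IsTransmission (c : N.Code A B O k n) (x : Fin s → Fin k → A)
    (z u : E → Fin n → B) : Prop where
  of_source : ∀ e i, N.tail e = N.source i → u e = c.srcEnc i e (x i) + z e
  of_relay : ∀ e, (∀ i, N.tail e ≠ N.source i) →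
    u e = c.relayEnc e (fun d => u d.1) + z e

/-- The code computes `f` (`k` times) against `τ` errors: whatever the source messages are, and
whatever errors occur on at most `τ` edges, the sink decodes the `k` values of `f` correctly. -/
def ComputesAgainst (c : N.Code A B O k n) (f : (Fin s → A) → O) (τ : ℕ) : Prop :=
  ∀ (x : Fin s → Fin k → A) (z u : E → Fin n → B),
    {e | z e ≠ 0}.ncard ≤ τ → c.IsTransmission x z u →
      ∀ j, c.decode (fun d => u d.1) j = f (fun i => x i j)

end Code

/-- The robust computing capacity: the supremum of the rates `k / n` of the `(k, n)` network
codes over `B` that compute `f` against `τ` errors. -/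
noncomputable def robustCapacity (N : Network V E s) {A O : Type*} (B : Type*) [AddCommGroup B]
    (f : (Fin s → A) → O) (τ : ℕ) : EReal :=
  sSup {r : EReal | ∃ k n : ℕ, 0 < k ∧ 0 < n ∧
    (∃ c : N.Code A B O k n, c.ComputesAgainst f τ) ∧ r = (((k : ℝ) / (n : ℝ) : ℝ) : EReal)}

theorem wellFounded_edges [Finite E] (N : Network V E s) :
    WellFounded (fun d e : E => N.head d = N.tail e) := by
  have key : ∀ d e : E, Relation.TransGen (fun d e : E => N.head d = N.tail e) d e →
      ∃ p, N.IsPath (N.tail d) (N.tail e) p := by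
    intro d e h
    induction h using Relation.TransGen.head_induction_on with
    | @single a h => exact ⟨[a], h ▸ DirMultigraph.IsPath.single a⟩
    | @head a b h _ ih =>
      obtain ⟨p, hp⟩ := ih
      exact ⟨a :: p, DirMultigraph.IsPath.cons a (h ▸ hp)⟩
  have : IsTrans E (Relation.TransGen (fun d e : E => N.head d = N.tail e)) :=
    ⟨fun _ _ _ => Relation.TransGen.trans⟩
  have : Std.Irrefl (Relation.TransGen (fun d e : E => N.head d = N.tail e)) :=
    ⟨fun e h => (key e e h).elim fun p hp => N.acyclic _ p hp⟩
  have wf := Finite.wellFounded_of_trans_of_irrefl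
    (Relation.TransGen (fun d e : E => N.head d = N.tail e))
  exact ⟨fun e => (Subrelation.accessible (q := fun d e : E => N.head d = N.tail e)
    (fun h => Relation.TransGen.single (r := fun d e : E => N.head d = N.tail e) h)
    (wf.apply e))⟩

/-- Source messages and errors determine the words carried by the edges. -/
theorem Code.existsUnique_isTransmission [Finite E] {N : Network V E s} {A B O : Type*}
    [AddCommGroup B] {k n : ℕ} (c : N.Code A B O k n) (x : Fin s → Fin k → A)
    (z : E → Fin n → B) : ∃! u, c.IsTransmission x z u := by
  classical
  have wf := N.wellFounded_edges
  let F : (e : E) → ((d : E) → N.head d = N.tail e → (Fin n → B)) → (Fin n → B) :=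
    fun e ih => if h : ∃ i, N.tail e = N.source i then c.srcEnc h.choose e (x h.choose) + z e
      else c.relayEnc e (fun d => ih d.1 d.2) + z e
  have hu : ∀ e, wf.fix F e = F e (fun d _ => wf.fix F d) := fun e => wf.fix_eq F e
  refine ⟨wf.fix F, ⟨fun e i hi => ?_, fun e he => ?_⟩, fun u hu' => ?_⟩
  · have h : ∃ i, N.tail e = N.source i := ⟨i, hi⟩
    have hc : h.choose = i := N.source_injective (h.choose_spec.symm.trans hi)
    rw [hu]
    simp only [F, dif_pos h, hc]
  · have h : ¬ ∃ i, N.tail e = N.source i := fun ⟨i, hi⟩ => he i hi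
    rw [hu]
    simp only [F, dif_neg h]
  · funext e
    induction e using wf.induction with
    | _ e ih =>
      rw [hu]
      by_cases h : ∃ i, N.tail e = N.source i
      · simp only [F, dif_pos h]
        exact hu'.of_source e _ h.choose_spec
      · simp only [F, dif_neg h]
        rw [hu'.of_relay e (fun i hi => h ⟨i, hi⟩)]
        congr 2
        funext d
        exact ih d.1 d.2

end Network

/-!
Run the network backwards. Let every cut have at least `k + 2 * τ` edges, and give every edge `e` a
transfer vector `w e` of dimension `k + 2 * τ`: any vector if `e` enters the sink, and otherwise an
element of the span of the transfer vectors of the edges that leave the head of `e`. If each choice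
avoids those spans of vectors chosen earlier that do not contain all permitted vectors, then, by
induction against the flow, the vectors of a set of edges have rank at least `k + 2 * τ` or the
size of a minimum cut between these edges and the sink. So the transfer vectors of the edges that
leave a source span the whole space.

Let the relays form the linear combinations that express `w e` through the vectors of the
following edges. Then the sink, which weights what it receives with the transfer vectors, obtains
`∑ e, b e • w e`, where `b e` is the symbol that enters the network at the edge `e`, from a source
or as an error. Hence every source can contribute any vector it likes. In the `j`-th of `l` uses of
the network, the source `i` contributes `G (T i j • x i)` for a linear map `G` on the messages, and
`τ` errors add an element of the span of `τ` transfer vectors. The range of a generic `G` meets the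
span of any `2 * τ` transfer vectors only in `0`, so the sink can recover `∑ i, T i j • x i`. All
subspaces to be avoided are indexed by sets of edges, which is why more than `2 ^ |E|` field
elements suffice.
-/

section LinearAlgebra

open Submodule Module

variable {F M ι : Type*} [Field F] [AddCommGroup M] [Module F M]

theorem exists_mem_forall_mem_imp_le (hι : ENat.card ι < ENat.card F) (U : Submodule F M)
    (p : ι → Submodule F M) : ∃ x ∈ U, ∀ i, x ∈ p i → U ≤ p i := by
  have : Finite ι := ENat.card_lt_top.1 (hι.trans_le le_top)
  have := Fintype.ofFinite {i // ¬U ≤ p i}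
  have hcard : ((Finset.univ : Finset {i // ¬U ≤ p i}).card : ℕ∞) < ENat.card F := by
    rw [Finset.card_univ, ← ENat.card_eq_coe_fintype_card]
    exact (ENat.card_le_card_of_injective Subtype.val_injective).trans_lt hι
  obtain ⟨⟨x, hxU⟩, -, hx⟩ := Set.exists_of_ssubset <|
    iUnion_ssubset_of_forall_ne_top_of_card_lt Finset.univ
      (fun i : {i // ¬U ≤ p i} => (p i).comap U.subtype)
      (fun i h => i.2 (comap_subtype_eq_top.1 h)) hcard
  refine ⟨x, hxU, fun i hxi => ?_⟩
  by_contra hUi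
  exact hx (Set.mem_iUnion₂.2 ⟨⟨i, hUi⟩, Finset.mem_univ _, hxi⟩)

theorem exists_forall_linearIndependent_mkQ_comp (hι : ENat.card ι < ENat.card F)
    (p : ι → Submodule F M) {k : ℕ} (hp : ∀ i, k ≤ finrank F (M ⧸ p i)) :
    ∃ v : Fin k → M, ∀ i, LinearIndependent F ((p i).mkQ ∘ v) := by
  induction k with
  | zero => exact ⟨Fin.elim0, fun i => linearIndependent_empty_type⟩
  | succ k ih =>
    obtain ⟨v, hv⟩ := ih fun i => (Nat.le_succ k).trans (hp i)
    obtain ⟨x, -, hx⟩ := exists_mem_forall_mem_imp_le hι ⊤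
      fun i => (span F (Set.range ((p i).mkQ ∘ v))).comap (p i).mkQ
    refine ⟨Fin.cons x v, fun i => ?_⟩
    rw [Fin.comp_cons (p i).mkQ, linearIndependent_finCons]
    refine ⟨hv i, fun hxi => ?_⟩
    have hspan : span F (Set.range ((p i).mkQ ∘ v)) = ⊤ := by
      rw [eq_top_iff, ← (p i).range_mkQ, LinearMap.range_eq_map, map_le_iff_le_comap]
      exact hx i hxi
    have hle := finrank_range_le_card (R := F) ((p i).mkQ ∘ v)
    rw [Set.finrank, hspan, finrank_top, Fintype.card_fin] at hle
    exact absurd (hp i) (by omega)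

end LinearAlgebra

section ErrorCorrection

open Submodule Module

variable {R M Y E : Type*} [Ring R] [AddCommGroup M] [Module R M] [AddCommGroup Y] [Module R Y]

/-- The linear code `G` detects `δ` errors, when an error in the position `e` adds a multiple of
`w e` to the received vector: a nonzero codeword cannot arise from errors in `δ` positions. -/
def DetectsErrors (w : E → M) (G : Y →ₗ[R] M) (δ : ℕ) : Prop :=
  ∀ S : Set E, S.encard ≤ δ → ∀ y, G y ∈ span R (w '' S) → y = 0

theorem DetectsErrors.exists_decoder {w : E → M} {G : Y →ₗ[R] M} {τ : ℕ}
    (hG : DetectsErrors w G (2 * τ)) :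
    ∃ D : M → Y, ∀ S : Set E, S.encard ≤ τ → ∀ y, ∀ m ∈ span R (w '' S), D (G y + m) = y := by
  let received : Y × {m // ∃ S : Set E, S.encard ≤ τ ∧ m ∈ span R (w '' S)} → M :=
    fun ym => G ym.1 + ym.2
  have hfactors : Function.FactorsThrough Prod.fst received := by
    rintro ⟨y, m, S, hS, hm⟩ ⟨y', m', S', hS', hm'⟩ (heq : G y + m = G y' + m')
    have hcard : (S ∪ S').encard ≤ (2 * τ : ℕ) := by
      refine (Set.encard_union_le S S').trans ((add_le_add hS hS').trans_eq ?_)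
      rw [two_mul, Nat.cast_add]
    refine sub_eq_zero.1 (hG _ hcard (y - y') ?_)
    rw [map_sub, sub_eq_sub_iff_add_eq_add.2 (heq.trans (add_comm _ _))]
    exact sub_mem (span_mono (by gcongr; exact Set.subset_union_right) hm')
      (span_mono (by gcongr; exact Set.subset_union_left) hm)
  exact ⟨Function.extend received Prod.fst 0, fun S hS y m hm =>
    hfactors.extend_apply 0 (y, ⟨m, S, hS, hm⟩)⟩

theorem exists_detectsErrors {F : Type*} [Field F] [Module F M] [FiniteDimensional F M] [Finite E]
    (hF : ENat.card (Set E) < ENat.card F) (w : E → M) {k δ : ℕ} (hk : k + δ ≤ finrank F M) :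
    ∃ G : (Fin k → F) →ₗ[F] M, DetectsErrors w G δ := by
  have hcodim : ∀ S : {S : Set E // S.encard ≤ δ}, k ≤ finrank F (M ⧸ span F (w '' S)) := by
    rintro ⟨S, hS⟩
    have := Fintype.ofFinite (w '' S)
    have hspan : finrank F (span F (w '' S)) ≤ δ := by
      refine (finrank_span_le_card _).trans ?_
      rw [← Set.ncard_eq_toFinset_card']
      rw [← S.toFinite.cast_ncard_eq, Nat.cast_le] at hS
      exact (Set.ncard_image_le).trans hS
    have := finrank_quotient_add_finrank (span F (w '' S))
    lia
  obtain ⟨v, hv⟩ := exists_forall_linearIndependent_mkQ_comp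
    ((ENat.card_le_card_of_injective Subtype.val_injective).trans_lt hF) _ hcodim
  refine ⟨Fintype.linearCombination F v, fun S hS y hy => ?_⟩
  refine funext (Fintype.linearIndependent_iff.1 (hv ⟨S, hS⟩) y ?_)
  have hmk := (Quotient.mk_eq_zero _).2 hy
  rwa [Fintype.linearCombination_apply, ← mkQ_apply, map_sum] at hmk

end ErrorCorrection

namespace DirMultigraph

variable {V E : Type*} {G : DirMultigraph V E} {t : V}

theorem IsPath.exists_eq_cons {u v : V} {p : List E} (h : G.IsPath u v p) :
    ∃ e q, G.tail e = u ∧ p = e :: q := by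
  cases h with
  | single e => exact ⟨e, [], rfl, rfl⟩
  | cons e => exact ⟨e, _, rfl, rfl⟩

theorem IsPath.of_cons {u v : V} {e : E} {p : List E} (h : G.IsPath u v (e :: p))
    (he : G.head e ≠ v) : G.IsPath (G.head e) v p := by
  cases h with
  | single => exact absurd rfl he
  | cons _ hp => exact hp

/-- The set of edges `C` separates the edges in `A` from the vertex `t`: it meets every path to `t`
whose first edge is in `A`. In particular, an edge of `A` that enters `t` belongs to `C`. -/
def Separates (G : DirMultigraph V E) (t : V) (C : Finset E) (A : Set E) : Prop :=
  ∀ e ∈ A, ∀ u p, G.IsPath u t (e :: p) → ∃ d ∈ e :: p, d ∈ C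

theorem Separates.mono {C : Finset E} {A B : Set E} (h : G.Separates t C B) (hAB : A ⊆ B) :
    G.Separates t C A :=
  fun e he => h e (hAB he)

theorem Separates.insert [DecidableEq E] {C : Finset E} {A : Set E} (h : G.Separates t C A)
    (e : E) : G.Separates t (insert e C) (insert e A) := by
  rintro d (rfl | hd) u p hp
  · exact ⟨d, List.mem_cons_self, Finset.mem_insert_self d C⟩
  · obtain ⟨x, hx, hxC⟩ := h d hd u p hp
    exact ⟨x, hx, Finset.mem_insert_of_mem hxC⟩

theorem Separates.insert_of_out_subset {C : Finset E} {A : Set E} (h : G.Separates t C A) {e : E}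
    (he : G.head e ≠ t) (hA : {d | G.tail d = G.head e} ⊆ A) :
    G.Separates t C (Insert.insert e A) := by
  rintro d (rfl | hd) u p hp
  · obtain ⟨d', q, hd', rfl⟩ := (hp.of_cons he).exists_eq_cons
    obtain ⟨x, hx, hxC⟩ := h d' (hA hd') _ q (hp.of_cons he)
    exact ⟨x, List.mem_cons_of_mem d hx, hxC⟩
  · exact h d hd u p hp

section TransferVectors

open Submodule Module

variable {F M : Type*} [Field F] [AddCommGroup M] [Module F M]

/-- The subspace `W` is as large as the cuts between the edges in `A` and the vertex `t` permit: it
is the whole space, or its dimension is at least the size of some such cut. -/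
def AttainsMinCut (G : DirMultigraph V E) (t : V) (A : Set E) (W : Submodule F M) : Prop :=
  W = ⊤ ∨ ∃ C, G.Separates t C A ∧ C.card ≤ finrank F W

theorem AttainsMinCut.mono {A B : Set E} {W : Submodule F M} (h : G.AttainsMinCut t B W)
    (hAB : A ⊆ B) : G.AttainsMinCut t A W :=
  h.imp_right fun ⟨C, hC, hle⟩ => ⟨C, hC.mono hAB, hle⟩

theorem AttainsMinCut.insert_of_out_subset {A : Set E} {W : Submodule F M}
    (h : G.AttainsMinCut t A W) {e : E} (he : G.head e ≠ t)
    (hA : {d | G.tail d = G.head e} ⊆ A) : G.AttainsMinCut t (insert e A) W :=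
  h.imp_right fun ⟨C, hC, hle⟩ => ⟨C, hC.insert_of_out_subset he hA, hle⟩

theorem AttainsMinCut.insert_of_notMem {A : Set E} {W : Submodule F M} [FiniteDimensional F W]
    (h : G.AttainsMinCut t A W) (e : E) {x : M} (hx : x ∉ W) :
    G.AttainsMinCut t (insert e A) (span F {x} ⊔ W) := by
  classical
  obtain rfl | ⟨C, hC, hle⟩ := h
  · exact absurd mem_top hx
  refine .inr ⟨insert e C, hC.insert e, (Finset.card_insert_le e C).trans ?_⟩
  have hlt : W < span F {x} ⊔ W :=
    right_lt_sup.2 fun hxW => hx (hxW (mem_span_singleton_self x))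
  have := finrank_lt_finrank_of_lt hlt
  omega

open Classical in
/-- The subspace in which a linear code allows the transfer vector of the edge `e` to be chosen,
where `w` lists the transfer vectors: the vertex `t` observes the word on an edge that enters `t`
directly, and it learns about the word on any other edge `e` only through the edges that leave
`G.head e`. -/
noncomputable def transferSpan (G : DirMultigraph V E) (F : Type*) [Field F] [Module F M] (t : V)
    (w : E → M) (e : E) : Submodule F M :=
  if G.head e = t then ⊤ else span F (w '' {d | G.tail d = G.head e})

theorem transferSpan_of_head_eq {e : E} (he : G.head e = t) (w : E → M) :
    G.transferSpan F t w e = ⊤ :=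
  if_pos he

theorem transferSpan_of_head_ne {e : E} (he : G.head e ≠ t) (w : E → M) :
    G.transferSpan F t w e = span F (w '' {d | G.tail d = G.head e}) :=
  if_neg he

theorem transferSpan_congr {w w' : E → M} {e : E}
    (h : Set.EqOn w w' {d | G.tail d = G.head e}) :
    G.transferSpan F t w e = G.transferSpan F t w' e := by
  rw [transferSpan, transferSpan, h.image_eq]

/-- The transfer vectors `w` of the edges in `P`, a set which contains with an edge all edges that
follow it, form a generic linear code: their spans are as large as the cuts permit. -/
structure IsGenericOn (G : DirMultigraph V E) (F : Type*) [Field F] [Module F M] (t : V)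
    (w : E → M) (P : Set E) : Prop where
  out_subset : ∀ e ∈ P, {d | G.tail d = G.head e} ⊆ P
  mem_transferSpan : ∀ e ∈ P, w e ∈ G.transferSpan F t w e
  attainsMinCut : ∀ A ⊆ P, G.AttainsMinCut t A (span F (w '' A))

namespace IsGenericOn

variable {w w' : E → M} {P : Set E}

theorem congr (h : G.IsGenericOn F t w P) (hw : Set.EqOn w w' P) : G.IsGenericOn F t w' P where
  out_subset := h.out_subset
  mem_transferSpan e he := by
    rw [← hw he, ← transferSpan_congr (hw.mono (h.out_subset e he))]
    exact h.mem_transferSpan e he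
  attainsMinCut A hA := (hw.mono hA).image_eq ▸ h.attainsMinCut A hA

theorem attainsMinCut_insert_of_transferSpan_le (h : G.IsGenericOn F t w P) {e : E}
    (he : {d | G.tail d = G.head e} ⊆ P) {A : Set E} (hA : A ⊆ P)
    (hspan : G.transferSpan F t w e ≤ span F (w '' A)) :
    G.AttainsMinCut t (insert e A) (span F (w '' A)) := by
  by_cases hsink : G.head e = t
  · rw [transferSpan_of_head_eq hsink, top_le_iff] at hspan
    exact .inl hspan
  · rw [transferSpan_of_head_ne hsink] at hspan
    have hunion := h.attainsMinCut (A ∪ {d | G.tail d = G.head e}) (Set.union_subset hA he)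
    rw [Set.image_union, span_union, sup_eq_left.2 hspan] at hunion
    exact (hunion.insert_of_out_subset hsink Set.subset_union_right).mono
      (Set.insert_subset_insert Set.subset_union_left)

theorem insert [Finite E] (h : G.IsGenericOn F t w P) {e : E}
    (he : {d | G.tail d = G.head e} ⊆ P) (hmem : w e ∈ G.transferSpan F t w e)
    (hgen : ∀ A ⊆ P, w e ∈ span F (w '' A) → G.transferSpan F t w e ≤ span F (w '' A)) :
    G.IsGenericOn F t w (insert e P) where
  out_subset := by
    rintro d (rfl | hd)
    · exact he.trans (Set.subset_insert _ _)
    · exact (h.out_subset d hd).trans (Set.subset_insert _ _)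
  mem_transferSpan := by
    rintro d (rfl | hd)
    · exact hmem
    · exact h.mem_transferSpan d hd
  attainsMinCut A hA := by
    by_cases heA : e ∈ A
    · have hAP : A \ {e} ⊆ P := Set.sdiff_singleton_subset_iff.2 hA
      rw [← Set.insert_sdiff_self_of_mem heA, Set.image_insert_eq, span_insert]
      by_cases hwe : w e ∈ span F (w '' (A \ {e}))
      · rw [sup_eq_right.2 ((span_singleton_le_iff_mem _ _).2 hwe)]
        exact h.attainsMinCut_insert_of_transferSpan_le he hAP (hgen _ hAP hwe)
      · have := FiniteDimensional.span_of_finite F ((Set.toFinite (A \ {e})).image w)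
        exact (h.attainsMinCut _ hAP).insert_of_notMem e hwe
    · exact h.attainsMinCut A ((Set.subset_insert_iff_of_notMem heA).1 hA)

theorem exists_insert [Finite E] (hF : ENat.card (Set E) < ENat.card F)
    (h : G.IsGenericOn F t w P) {e : E} (heP : e ∉ P) (he : {d | G.tail d = G.head e} ⊆ P) :
    ∃ w' : E → M, G.IsGenericOn F t w' (Insert.insert e P) := by
  classical
  obtain ⟨x, hxU, hx⟩ := exists_mem_forall_mem_imp_le hF (G.transferSpan F t w e)
    fun A => span F (w '' A)
  have hEq : Set.EqOn w (Function.update w e x) P := fun d hd =>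
    (Function.update_of_ne (ne_of_mem_of_not_mem hd heP) x w).symm
  refine ⟨Function.update w e x, (h.congr hEq).insert he ?_ fun A hA hmem => ?_⟩
  · rwa [Function.update_self, ← transferSpan_congr (hEq.mono he)]
  · rw [Function.update_self, ← (hEq.mono hA).image_eq] at hmem
    rw [← transferSpan_congr (hEq.mono he), ← (hEq.mono hA).image_eq]
    exact hx A hmem

end IsGenericOn

theorem isGenericOn_empty (w : E → M) : G.IsGenericOn F t w ∅ where
  out_subset := by simp
  mem_transferSpan := by simp
  attainsMinCut A hA := .inr ⟨∅, fun e he => (hA he).elim, Nat.zero_le _⟩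

theorem exists_isGenericOn_univ [Finite E] (hF : ENat.card (Set E) < ENat.card F)
    (hG : WellFounded fun d e : E => G.tail d = G.head e) (t : V) :
    ∃ w : E → M, G.IsGenericOn F t w Set.univ := by
  obtain ⟨P, ⟨w, hw⟩, hmax⟩ :=
    (Set.toFinite {P : Set E | ∃ w : E → M, G.IsGenericOn F t w P}).exists_maximal
      ⟨∅, 0, isGenericOn_empty 0⟩
  obtain rfl | hP := eq_or_ne P Set.univ
  · exact ⟨w, hw⟩
  obtain ⟨e, heP, hmin⟩ := hG.has_min Pᶜ (Set.nonempty_compl.2 hP)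
  have hout : {d | G.tail d = G.head e} ⊆ P := fun d hd => by_contra fun hdP => hmin d hdP hd
  exact absurd (hmax (hw.exists_insert hF heP hout) (Set.subset_insert e P)
    (Set.mem_insert e P)) heP

end TransferVectors

end DirMultigraph

section Flow

variable {R M E : Type*} [CommRing R] [AddCommGroup M] [Module R M] [Fintype E]

theorem exists_sum_smul_eq_of_mem_span_image {w : E → M} {S : Set E} {x : M}
    (hx : x ∈ Submodule.span R (w '' S)) :
    ∃ c : E → R, (∀ e ∉ S, c e = 0) ∧ ∑ e, c e • w e = x := by
  obtain ⟨c, hc, rfl⟩ := (Finsupp.mem_span_image_iff_linearCombination R).1 hx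
  refine ⟨c, (Finsupp.mem_supported' R c).1 hc, ?_⟩
  rw [Finsupp.linearCombination_apply, Finsupp.sum_fintype _ _ fun e => zero_smul R (w e)]

theorem sum_observed_smul_eq_sum_injected_smul {observed : E → Prop} [DecidablePred observed]
    {w : E → M} {a : E → E → R} {b u : E → R}
    (hw : ∀ d, ∑ e, a d e • w e = if observed d then 0 else w d)
    (hu : ∀ e, u e = b e + ∑ d, a d e * u d) :
    ∑ d : {d // observed d}, u d • w d = ∑ e, b e • w e := by
  have htotal : ∑ e, u e • w e = ∑ e, b e • w e + ∑ d : {d // ¬observed d}, u d • w d :=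
    calc ∑ e, u e • w e
        = ∑ e, b e • w e + ∑ e, ∑ d, (a d e * u d) • w e := by
          simp_rw [← Finset.sum_add_distrib, ← Finset.sum_smul, ← add_smul, ← hu]
      _ = ∑ e, b e • w e + ∑ d, u d • ∑ e, a d e • w e := by
          rw [Finset.sum_comm]
          simp_rw [Finset.smul_sum, smul_smul, mul_comm]
      _ = ∑ e, b e • w e + ∑ d : {d // ¬observed d}, u d • w d := by
          rw [← Fintype.sum_subtype_add_sum_subtype observed fun d => u d • ∑ e, a d e • w e]
          have hobserved : ∀ d : {d // observed d}, ∑ e, a d e • w e = 0 := fun d => by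
            rw [hw, if_pos d.2]
          have hrelayed : ∀ d : {d // ¬observed d}, ∑ e, a d e • w e = w d := fun d => by
            rw [hw, if_neg d.2]
          simp only [hobserved, hrelayed, smul_zero, Finset.sum_const_zero, zero_add]
  rw [← Fintype.sum_subtype_add_sum_subtype observed] at htotal
  exact add_right_cancel htotal

end Flow

namespace DirMultigraph

variable {V E : Type*} {G : DirMultigraph V E} {t : V}

theorem exists_relay_coefficients {F M : Type*} [Field F] [AddCommGroup M] [Module F M]
    [Fintype E] [DecidableEq V] {w : E → M} (hw : ∀ e, w e ∈ G.transferSpan F t w e) :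
    ∃ a : E → E → F, (∀ d e, G.head d ≠ G.tail e → a d e = 0) ∧
      ∀ d, ∑ e, a d e • w e = if G.head d = t then 0 else w d := by
  have hrow : ∀ d, ∃ c : E → F, (∀ e, G.head d ≠ G.tail e → c e = 0) ∧
      ∑ e, c e • w e = if G.head d = t then 0 else w d := by
    intro d
    split_ifs with hd
    · exact ⟨0, by simp⟩
    · have hwd := hw d
      rw [transferSpan_of_head_ne hd] at hwd
      obtain ⟨c, hc, hcw⟩ := exists_sum_smul_eq_of_mem_span_image hwd
      exact ⟨c, fun e he => hc e (Ne.symm he), hcw⟩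
  choose a ha haw using hrow
  exact ⟨a, ha, haw⟩

end DirMultigraph

namespace Network

variable {V E : Type*} {s : ℕ} {N : Network V E s}

theorem wellFounded_edges_swap [Finite E] (N : Network V E s) :
    WellFounded fun d e : E => N.tail d = N.head e := by
  let follows : E → E → Prop := fun d e => N.tail d = N.head e
  have hirrefl : Std.Irrefl (Relation.TransGen follows) := ⟨fun e he => by
    rw [← Relation.transGen_swap] at he
    exact N.wellFounded_edges.transGen.irrefl.irrefl e
      (Relation.TransGen.mono (fun _ _ h => h.symm) _ _ he)⟩
  exact Subrelation.wf (q := follows) Relation.TransGen.single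
    (Finite.wellFounded_of_trans_of_irrefl (Relation.TransGen follows))

theorem mem_cuts_of_separates_out {C : Finset E} {i : Fin s}
    (h : N.Separates N.sink C {e | N.tail e = N.source i}) : C ∈ N.cuts := by
  refine ⟨i, fun p hp => ?_⟩
  obtain ⟨e, q, he, rfl⟩ := hp.exists_eq_cons
  exact h e he _ q hp

section LinearCode

variable {R M O : Type*} [CommRing R] [AddCommGroup M] [Module R M] [Fintype E] [DecidableEq V]
  {k n : ℕ}

/-- The network code whose relays form linear combinations: the word received on the edge `d`
enters the word sent on the edge `e` with the coefficient `a d e`. The sources use the encoders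
`b`. For every position `j` of the words, the sink weights the symbols that it receives with the
transfer vectors `w`, and it applies `D` to the resulting vectors. -/
def linearCode (N : Network V E s) (a : E → E → R) (b : Fin s → E → (Fin k → R) → Fin n → R)
    (w : E → M) (D : (Fin n → M) → Fin k → O) : N.Code R R O k n where
  srcEnc := b
  relayEnc e v := ∑ d : N.In (N.tail e), a d e • v d
  decode v := D fun j => ∑ d : N.In N.sink, v d j • w d

variable {a : E → E → R} {b : Fin s → E → (Fin k → R) → Fin n → R} {w : E → M}
  {D : (Fin n → M) → Fin k → O} {x : Fin s → Fin k → R} {z u : E → Fin n → R}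

theorem eq_of_isTransmission_linearCode (ha : ∀ d e, N.head d ≠ N.tail e → a d e = 0)
    (hb : ∀ i e y, N.tail e ≠ N.source i → b i e y = 0)
    (hu : (N.linearCode a b w D).IsTransmission x z u) (e : E) :
    u e = (∑ i, b i e (x i) + z e) + ∑ d, a d e • u d := by
  by_cases he : ∃ i, N.tail e = N.source i
  · obtain ⟨i, hi⟩ := he
    have hsource : ∑ i', b i' e (x i') = b i e (x i) :=
      Fintype.sum_eq_single i fun i' hi' =>
        hb i' e _ fun h => hi' (N.source_injective (h.symm.trans hi))
    have hrelay : ∑ d, a d e • u d = 0 := Finset.sum_eq_zero fun d _ => by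
      rw [ha d e fun h => N.no_edge_into_source d i (h.trans hi), zero_smul]
    rw [hsource, hrelay, add_zero]
    exact hu.of_source e i hi
  · rw [not_exists] at he
    have hsource : ∑ i, b i e (x i) = 0 := Finset.sum_eq_zero fun i _ => hb i e _ (he i)
    have hrelay : ∑ d : N.In (N.tail e), a d e • u d = ∑ d, a d e • u d :=
      Fintype.sum_of_injective Subtype.val Subtype.val_injective _ _
        (fun d hd => by rw [ha d e (by simpa using hd), zero_smul]) fun _ => rfl
    rw [hsource, zero_add, ← hrelay, add_comm]
    exact hu.of_relay e he

theorem sum_sink_smul_of_isTransmission_linearCode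
    (ha : ∀ d e, N.head d ≠ N.tail e → a d e = 0)
    (haw : ∀ d, ∑ e, a d e • w e = if N.head d = N.sink then 0 else w d)
    (hb : ∀ i e y, N.tail e ≠ N.source i → b i e y = 0)
    (hu : (N.linearCode a b w D).IsTransmission x z u) (j : Fin n) :
    ∑ d : N.In N.sink, u d j • w d =
      ∑ i, ∑ e, b i e (x i) j • w e + ∑ e, z e j • w e := by
  have huj : ∀ e, u e j = (∑ i, b i e (x i) j + z e j) + ∑ d, a d e * u d j := fun e => by
    simpa using congrFun (eq_of_isTransmission_linearCode ha hb hu e) j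
  rw [sum_observed_smul_eq_sum_injected_smul haw huj, Finset.sum_comm]
  simp_rw [add_smul, Finset.sum_smul, Finset.sum_add_distrib]

end LinearCode

theorem exists_source_encoder {R M : Type*} [CommRing R] [AddCommGroup M] [Module R M] [Fintype E]
    {w : E → M} {i : Fin s}
    (hw : Submodule.span R (w '' {e | N.tail e = N.source i}) = ⊤) {Y : Type*} (f : Y → M) :
    ∃ β : Y → E → R, (∀ y e, N.tail e ≠ N.source i → β y e = 0) ∧
      ∀ y, ∑ e, β y e • w e = f y := by
  choose β hβ hβw using fun y => exists_sum_smul_eq_of_mem_span_image (R := R) (x := f y)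
    (hw ▸ Submodule.mem_top)
  exact ⟨β, hβ, hβw⟩

variable {F M : Type*} [Field F] [AddCommGroup M] [Module F M]

theorem exists_computesAgainst_of_detectsErrors [Finite E] {w : E → M}
    (hw : ∀ e, w e ∈ N.transferSpan F N.sink w e)
    (hsource : ∀ i, Submodule.span F (w '' {e | N.tail e = N.source i}) = ⊤) {k l τ : ℕ}
    {G : (Fin k → F) →ₗ[F] M} (hG : DetectsErrors w G (2 * τ)) (T : Matrix (Fin s) (Fin l) F) :
    ∃ c : N.Code F F (Fin l → F) k l,
      c.ComputesAgainst (fun x : Fin s → F => Matrix.vecMul x T) τ := by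
  classical
  have := Fintype.ofFinite E
  obtain ⟨a, ha, haw⟩ := DirMultigraph.exists_relay_coefficients hw
  choose β hβ hβw using fun i => exists_source_encoder (hsource i) G
  obtain ⟨D, hD⟩ := hG.exists_decoder
  refine ⟨N.linearCode a (fun i e y j => β i (T i j • y) e) w fun Y m j => D (Y j) m,
    fun x z u hz hu m => funext fun j => ?_⟩
  have hreceived : ∑ d : N.In N.sink, u d j • w d =
      G (∑ i, T i j • x i) + ∑ e, z e j • w e := by
    rw [sum_sink_smul_of_isTransmission_linearCode ha haw
      (fun i e y he => funext fun j => hβ i _ e he) hu, map_sum]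
    simp_rw [hβw]
  have herror : ∑ e, z e j • w e ∈ Submodule.span F (w '' {e | z e ≠ 0}) := by
    refine Submodule.sum_mem _ fun e _ => ?_
    by_cases he : z e = 0
    · simp [he]
    · exact Submodule.smul_mem _ _ (Submodule.subset_span ⟨e, he, rfl⟩)
  have hcard : {e | z e ≠ 0}.encard ≤ τ := by
    rwa [← (Set.toFinite _).cast_ncard_eq, Nat.cast_le]
  calc D (∑ d : N.In N.sink, u d j • w d) m
      = (∑ i, T i j • x i) m := by rw [hreceived, hD _ hcard _ _ herror]
    _ = Matrix.vecMul (fun i => x i m) T j := by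
      simp [Matrix.vecMul, dotProduct, mul_comm]

theorem exists_computesAgainst_of_le_card_cuts [Finite E] (N : Network V E s)
    (hF : ENat.card (Set E) < ENat.card F) {k τ : ℕ} (hk : ∀ C ∈ N.cuts, k + 2 * τ ≤ C.card)
    {l : ℕ} (T : Matrix (Fin s) (Fin l) F) :
    ∃ c : N.Code F F (Fin l → F) k l,
      c.ComputesAgainst (fun x : Fin s → F => Matrix.vecMul x T) τ := by
  obtain ⟨w, hw⟩ := DirMultigraph.exists_isGenericOn_univ (M := Fin (k + 2 * τ) → F) hF
    N.wellFounded_edges_swap N.sink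
  obtain ⟨G, hG⟩ := exists_detectsErrors hF w (k := k) (δ := 2 * τ) (by simp)
  have hsource : ∀ i, Submodule.span F (w '' {e | N.tail e = N.source i}) = ⊤ := fun i => by
    obtain htop | ⟨C, hC, hle⟩ := hw.attainsMinCut _ (Set.subset_univ {e | N.tail e = N.source i})
    · exact htop
    · refine Submodule.eq_top_of_finrank_eq (le_antisymm (Submodule.finrank_le _) ?_)
      rw [Module.finrank_fin_fun]
      exact (hk C (mem_cuts_of_separates_out hC)).trans hle
  exact exists_computesAgainst_of_detectsErrors
    (fun e => hw.mem_transferSpan e (Set.mem_univ e)) hsource hG T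

theorem div_le_robustCapacity {A B O : Type*} [AddCommGroup B] {f : (Fin s → A) → O} {k n τ : ℕ}
    (hk : 0 < k) (hn : 0 < n) (h : ∃ c : N.Code A B O k n, c.ComputesAgainst f τ) :
    ((k / n : ℝ) : EReal) ≤ N.robustCapacity B f τ :=
  le_sSup ⟨k, n, hk, hn, h, rfl⟩

theorem robustCapacity_eq_top_of_forall {A B O : Type*} [AddCommGroup B] {f : (Fin s → A) → O}
    {n τ : ℕ} (hn : 0 < n) (h : ∀ k, ∃ c : N.Code A B O k n, c.ComputesAgainst f τ) :
    N.robustCapacity B f τ = ⊤ := by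
  refine EReal.eq_top_iff_forall_lt _ |>.2 fun y => ?_
  obtain ⟨k, hk⟩ := exists_nat_gt (max y 0 * n)
  have hn' : (0 : ℝ) < n := by exact_mod_cast hn
  have hk0 : 0 < k := by exact_mod_cast (by positivity : 0 ≤ max y 0 * n).trans_lt hk
  refine lt_of_lt_of_le ?_ (div_le_robustCapacity hk0 hn (h k))
  exact EReal.coe_lt_coe_iff.2 ((le_max_left y 0).trans_lt ((lt_div_iff₀ hn').2 hk))

end Network

theorem mainTheorem4_general {V E : Type*} [Finite E] {s : ℕ} (N : Network V E s) {τ : ℕ}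
    (hτ : ∀ C ∈ N.cuts, 2 * τ < C.card) {F : Type*} [Field F]
    (hF : ENat.card (Set E) < ENat.card F) {l : ℕ} (hl : 1 ≤ l) (T : Matrix (Fin s) (Fin l) F) :
    (⨅ C ∈ N.cuts, (((((C.card : ℝ) - 2 * (τ : ℝ)) / (l : ℝ)) : ℝ) : EReal)) ≤
      N.robustCapacity F (fun x : Fin s → F => Matrix.vecMul x T) τ := by
  obtain hcuts | hcuts := N.cuts.eq_empty_or_nonempty
  · rw [Network.robustCapacity_eq_top_of_forall hl fun k =>
      N.exists_computesAgainst_of_le_card_cuts hF (by simp [hcuts]) T]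
    exact le_top
  · obtain ⟨C, hC, hmin⟩ := Set.exists_min_image N.cuts Finset.card (Set.toFinite _) hcuts
    have hCτ := hτ C hC
    obtain ⟨k, hk⟩ := Nat.exists_eq_add_of_lt hCτ
    have hcode := N.exists_computesAgainst_of_le_card_cuts hF (k := k + 1) (τ := τ)
      (fun C' hC' => (by omega : k + 1 + 2 * τ ≤ C.card).trans (hmin C' hC')) T
    refine (iInf₂_le C hC).trans (le_of_eq_of_le ?_
      (Network.div_le_robustCapacity k.succ_pos hl hcode))
    rw [hk]
    push_cast
    ring_nf

theorem mainTheorem4 {V E : Type*} [Fintype V] [Fintype E] {s : ℕ} (N : Network V E s)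
    (τ : ℕ) (hτ : ∀ C ∈ N.cuts, 2 * τ < C.card) :
    ∃ q₀ : ℕ, ∀ (F : Type*) [Field F] [Fintype F], q₀ ≤ Fintype.card F →
      ∀ (l : ℕ), 1 ≤ l → ∀ T : Matrix (Fin s) (Fin l) F,
        LinearIndependent F (fun j i => T i j) →
          (⨅ C ∈ N.cuts, (((((C.card : ℝ) - 2 * (τ : ℝ)) / (l : ℝ)) : ℝ) : EReal)) ≤
            N.robustCapacity F (fun x : Fin s → F => Matrix.vecMul x T) τ :=
  ⟨Fintype.card (Set E) + 1, fun F _ _ hF l hl T _ => mainTheorem4_general N hτ (by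
    rw [ENat.card_eq_coe_fintype_card, ENat.card_eq_coe_fintype_card]
    exact_mod_cast hF) hl T⟩
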